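/- Let $R$ be a small preadditive category (for instance a ring), let $\mathrm{Mod}\text{-}R$ be the category of right $R$-modules, i.e. additive functors $R^{\rm op}\to\mathbf{Ab}$, and let $\mathcal D$ be a definable subcategory of $\mathrm{Mod}\text{-}R$: the full subcategory of all modules $N$ with $\phi(N)=\psi(N)$ for all pairs $(\phi,\psi)$ in some set of pairs of pp formulas (existentially quantified finite systems of homogeneous $R$-linear equations). For pp formulas $\phi,\psi$ write $\phi\le_{\mathcal D}\psi$ if $\phi(N)\subseteq\psi(N)$ for every $N\in\mathcal D$. The pp-type of a finite tuple $\bar a$ in $M$ is ${\rm pp}^M(\bar a)=\{\psi \text{ pp}: \bar a\in\psi(M)\}$, and it is $\mathcal D$-generated by $\phi$ if it equals $\{\psi \text{ pp}: \phi\le_{\mathcal D}\psi\}$. A module $M\in\mathcal D$ is strictly $\mathcal D$-atomic if the pp-type of every finite tuple of $M$ is $\mathcal D$-generated by some pp formula and, whenever the pp-type of a finite tuple $\bar a$ of $M$ is $\mathcal D$-generated by $\phi$, then for every $N\in\mathcal D$ and every $\bar b\in\phi(N)$ there is a morphism $f:M\to N$ with $f\bar a=\bar b$. **Theorem.** A module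 $M\in\mathcal D$ is strictly $\mathcal D$-atomic if and only if there are an index set $\Lambda$ and a proper filter $\mathcal F$ on $\Lambda$ such that, for every pure epimorphism $\pi:P\to M$ with $P\in\mathcal D$, there are morphisms $f_\lambda:M\to P$ $(\lambda\in\Lambda)$ with $$\pi^*\circ f\circ\Delta_M=\Delta_M .$$ Here $M^*=M^\Lambda/\mathcal F$ and $P^*=P^\Lambda/\mathcal F$ are the reduced powers, $\pi^*=\pi^\Lambda/\mathcal F:P^*\to M^*$ is the morphism induced by $\pi$, $f=(f_\lambda)_\lambda/\mathcal F:M^*\to P^*$ is the reduced product of the $f_\lambda$, and $\Delta_M:M\to M^*$ is the diagonal embedding. -/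

import Mathlib

open CategoryTheory Opposite

universe u v w

/-- A pp formula `φ(x₁, …, xₙ)` in the language of right modules over the preadditive category `C`
(that is, of additive functors `Cᵒᵖ ⥤ Ab`), the free variable `xᵢ` having sort `σ i`.
It stands for `∃ y, ⋀ⱼ ∑ᵢ xᵢ rᵢⱼ + ∑ₖ yₖ sₖⱼ = 0`, where the variable `yₖ` has sort
`boundSort k`, the `j`-th equation lives in sort `eqSort j`, `rᵢⱼ = freeCoeff i j` and
`sₖⱼ = boundCoeff k j`. -/
structure PPFormula {C : Type u} [Category.{v} C] {n : ℕ} (σ : Fin n → C) where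
  numBound : ℕ
  boundSort : Fin numBound → C
  numEq : ℕ
  eqSort : Fin numEq → C
  freeCoeff : ∀ (i : Fin n) (j : Fin numEq), eqSort j ⟶ σ i
  boundCoeff : ∀ (k : Fin numBound) (j : Fin numEq), eqSort j ⟶ boundSort k

namespace PPFormula

variable {C : Type u} [Category.{v} C] {n : ℕ} {σ : Fin n → C}

/-- The solution set `φ(M)`. -/
def sol (φ : PPFormula σ) (M : Cᵒᵖ ⥤ AddCommGrpCat.{w}) : Set (∀ i, M.obj (op (σ i))) :=
  {a | ∃ b : ∀ k, M.obj (op (φ.boundSort k)), ∀ j,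
    ∑ i, M.map (φ.freeCoeff i j).op (a i) + ∑ k, M.map (φ.boundCoeff k j).op (b k) = 0}

/-- `φ ≤_D ψ`: one has `φ(N) ⊆ ψ(N)` for every `N` in `D`. -/
def LeOn (D : ObjectProperty (Cᵒᵖ ⥤ AddCommGrpCat.{w})) (φ ψ : PPFormula σ) : Prop :=
  ∀ N, D N → φ.sol N ⊆ ψ.sol N

/-- The pp-type generated by `φ` modulo `D`. -/
def generatedType (D : ObjectProperty (Cᵒᵖ ⥤ AddCommGrpCat.{w})) (φ : PPFormula σ) :
    Set (PPFormula σ) :=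
  {ψ | LeOn D φ ψ}

end PPFormula

/-- A pair of pp formulas in the same free variables. -/
structure PPPair (C : Type u) [Category.{v} C] where
  arity : ℕ
  sort : Fin arity → C
  fst : PPFormula sort
  snd : PPFormula sort

section

variable {C : Type u} [Category.{v} C]

/-- The pp-type of the tuple `a` in `M`. -/
def ppType (M : Cᵒᵖ ⥤ AddCommGrpCat.{w}) {n : ℕ} {σ : Fin n → C}
    (a : ∀ i, M.obj (op (σ i))) : Set (PPFormula σ) :=
  {φ | a ∈ φ.sol M}

/-- `D` is a definable subcategory of `Mod-C`: it consists of the right `C`-modules (additive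
functors `Cᵒᵖ ⥤ Ab`) on which every pair in some set of pairs of pp formulas is closed. -/
def IsDefinable [Preadditive C] (D : ObjectProperty (Cᵒᵖ ⥤ AddCommGrpCat.{w})) : Prop :=
  ∃ Φ : Set (PPPair C), ∀ M, D M ↔ M.Additive ∧ ∀ p ∈ Φ, p.fst.sol M = p.snd.sol M

/-- Every pp-type of a finite tuple of `M` is `D`-finitely generated. -/
def IsAtomicIn (D : ObjectProperty (Cᵒᵖ ⥤ AddCommGrpCat.{w}))
    (M : Cᵒᵖ ⥤ AddCommGrpCat.{w}) : Prop :=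
  ∀ (n : ℕ) (σ : Fin n → C) (a : ∀ i, M.obj (op (σ i))),
    ∃ φ : PPFormula σ, ppType M a = φ.generatedType D

/-- `M` (an object of `D`) is strictly `D`-atomic. -/
def IsStrictlyAtomicIn (D : ObjectProperty (Cᵒᵖ ⥤ AddCommGrpCat.{w}))
    (M : Cᵒᵖ ⥤ AddCommGrpCat.{w}) : Prop :=
  IsAtomicIn D M ∧
    ∀ (n : ℕ) (σ : Fin n → C) (a : ∀ i, M.obj (op (σ i))) (φ : PPFormula σ),
      ppType M a = φ.generatedType D →
        ∀ N, D N → ∀ b ∈ φ.sol N, ∃ f : M ⟶ N, ∀ i, f.app (op (σ i)) (a i) = b i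

/-- `f : K ⟶ P` is a pure monomorphism: it preserves pp-types of finite tuples. (The pp-type of `a`
is always contained in that of `f a`; injectivity follows by considering the formula `x = 0`.) -/
def IsPureMono {K P : Cᵒᵖ ⥤ AddCommGrpCat.{w}} (f : K ⟶ P) : Prop :=
  ∀ (n : ℕ) (σ : Fin n → C) (a : ∀ i, K.obj (op (σ i))),
    ppType K a = ppType P (fun i => f.app (op (σ i)) (a i))

/-- `π : P ⟶ M` is a pure epimorphism: `0 ⟶ ker π ⟶ P ⟶ M ⟶ 0` is pure-exact. -/
def IsPureEpi {P M : Cᵒᵖ ⥤ AddCommGrpCat.{w}} (π : P ⟶ M) : Prop :=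
  Epi π ∧ IsPureMono (Limits.kernel.ι π)

/-- The reduced product `A^Λ/F ⟶ B^Λ/F`, `(cᵢ)/F ↦ (fᵢ cᵢ)/F`, of a family of homomorphisms
of abelian groups. -/
def germMap {Λ : Type w} (F : Filter Λ) {A B : AddCommGrpCat.{w}} (f : Λ → (A ⟶ B)) :
    AddCommGrpCat.of (F.Germ A) ⟶ AddCommGrpCat.of (F.Germ B) :=
  AddCommGrpCat.ofHom
    { toFun := Filter.Germ.map' (fun c i => f i (c i))
        (fun c d h => h.mono fun i hi => by
          have hi' : c i = d i := hi
          simp only [hi'])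
      map_zero' := congrArg (fun c : Λ → B => (c : F.Germ B)) (funext fun i => map_zero (f i).hom)
      map_add' := fun x y => Filter.Germ.inductionOn₂ x y fun c d =>
        congrArg (fun e : Λ → B => (e : F.Germ B)) (funext fun i => map_add (f i).hom (c i) (d i)) }

@[simp] lemma germMap_coe {Λ : Type w} (F : Filter Λ) {A B : AddCommGrpCat.{w}} (f : Λ → (A ⟶ B))
    (c : Λ → A) : germMap F f (c : F.Germ A) = ((fun i => f i (c i) : Λ → B) : F.Germ B) := rfl

/-- The reduced power `M^Λ/F`, computed sortwise: an element of sort `X` is a family `(cᵢ)` of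
elements of `M` of sort `X`, up to equality on a set in `F`. -/
def reducedPower {Λ : Type w} (F : Filter Λ) (M : Cᵒᵖ ⥤ AddCommGrpCat.{w}) :
    Cᵒᵖ ⥤ AddCommGrpCat.{w} where
  obj X := AddCommGrpCat.of (F.Germ (M.obj X))
  map r := germMap F fun _ => M.map r
  map_id X := by
    ext x
    induction x using Filter.Germ.inductionOn with
    | h c =>
      refine (germMap_coe F _ c).trans ?_
      simp
  map_comp r s := by
    ext x
    induction x using Filter.Germ.inductionOn with
    | h c =>
      refine (germMap_coe F _ c).trans ?_
      simp only [Functor.map_comp]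
      rfl

/-- The reduced product `(fᵢ)/F : M^Λ/F ⟶ P^Λ/F` of a family of morphisms `fᵢ : M ⟶ P`. -/
def reducedProductMap {Λ : Type w} (F : Filter Λ) {M P : Cᵒᵖ ⥤ AddCommGrpCat.{w}}
    (f : Λ → (M ⟶ P)) : reducedPower F M ⟶ reducedPower F P where
  app X := germMap F fun i => (f i).app X
  naturality X Y r := by
    ext x
    induction x using Filter.Germ.inductionOn with
    | h c =>
      exact congrArg (fun e : Λ → P.obj Y => (e : F.Germ (P.obj Y)))
        (funext fun i => NatTrans.naturality_apply (f i) r (c i))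

/-- The diagonal `Δ_M : M ⟶ M^Λ/F`. -/
def diagonal {Λ : Type w} (F : Filter Λ) (M : Cᵒᵖ ⥤ AddCommGrpCat.{w}) :
    M ⟶ reducedPower F M where
  app X := AddCommGrpCat.ofHom
    { toFun := fun c => ((fun _ => c : Λ → M.obj X) : F.Germ (M.obj X))
      map_zero' := rfl
      map_add' := fun _ _ => rfl }
  naturality X Y r := by
    ext x
    rfl

end

/-!
Both conditions say that pure epimorphisms `π : P ⟶ M` in `D` split on finite tuples of `M`. The
equation in the reduced power means that each element `c` of `M` satisfies `π (fₗ c) = c` for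
`F`-many `l` (`diagonal_comp_eq_iff`). As a filter is closed under finite intersections and `F` is
proper, some `π ∘ fₗ` then fixes a given finite tuple. Conversely, if each finite set of elements is
fixed by some `π ∘ f`, then the finite subsets of `M`, with the filter `atTop`, index a family as
required, and this filter does not depend on `π`.

A strictly atomic `M` has these splittings: if `φ` generates the pp-type of `a`, then `a` lifts
along `π` to a solution of `φ` in `P` (`IsPureEpi.exists_lift`), which is the image of `a` under
some `M ⟶ P`.

For the other implication one pure epimorphism suffices, namely one from a strictly atomic module
(`IsLocallyGeneric.isStrictlyAtomicIn_of_locally_split`). It is built as follows. Over a module `A ⟶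
M`, consider all finite linear systems with constant terms in `A` that are solvable along every
morphism from `A` to a module of `D`, and adjoin to `A` a solution of each of them for each of its
solutions in `M`. Start with `A = 0`, iterate, and let `P` be the union.
* `P` lies in `D`: if `φ ≤_D ψ` and `φ(a)` holds at a stage, then the equations of `ψ(a)` form such
  a system, so `ψ(a)` holds at the next one (`sol_genericCover_subset`).
* `P ⟶ M` is a pure epimorphism, because homogeneous systems are among those adjoined to `0`
  (`exists_isPureEpi_genericCover`).
* `P` is strictly atomic: a finite tuple is reached with finitely many of the adjoined solutions,
  which generate the image of a finitely presented module from which all morphisms to `D` extend to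
  `P` (`IsLocallyGeneric.extension`, `isLocallyGeneric_genericCover`).
-/

/-! ### Adjoining solutions of linear systems -/

section

variable {C : Type u} [Category.{v} C]

/-- A finite system of linear equations in sorted unknowns; the constant terms are not part of the
data. -/
structure FinSystem (C : Type u) [Category.{v} C] where
  numVar : ℕ
  varSort : Fin numVar → C
  numEq : ℕ
  eqSort : Fin numEq → C
  coeff : ∀ (k : Fin numVar) (j : Fin numEq), eqSort j ⟶ varSort k

/-- `y` solves in `N` the system `S` with constant terms `t`. -/
def FinSystem.Solves (S : FinSystem C) (N : Cᵒᵖ ⥤ AddCommGrpCat.{w})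
    (t : ∀ j, N.obj (op (S.eqSort j))) (y : ∀ k, N.obj (op (S.varSort k))) : Prop :=
  ∀ j, t j + ∑ k, N.map (S.coeff k j).op (y k) = 0

lemma FinSystem.Solves.map {S : FinSystem C} {N N' : Cᵒᵖ ⥤ AddCommGrpCat.{w}}
    {t : ∀ j, N.obj (op (S.eqSort j))} {y : ∀ k, N.obj (op (S.varSort k))}
    (h : S.Solves N t y) (f : N ⟶ N') :
    S.Solves N' (fun j => f.app _ (t j)) (fun k => f.app _ (y k)) := by
  intro j
  have := congrArg (f.app _) (h j)
  simpa [map_add, map_sum, NatTrans.naturality_apply] using this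

namespace Adjoin

variable [Preadditive C] (A : Cᵒᵖ ⥤ AddCommGrpCat.{max u v w}) {I : Type (max u v w)}
  (S : I → FinSystem C) (t : ∀ i j, A.obj (op ((S i).eqSort j)))

/-- The value at `X` of the free module on generators `⟨i, k⟩` of sort `(S i).varSort k`, one for
each unknown of each system. -/
abbrev Free (X : C) : Type (max u v w) :=
  DirectSum (Σ i, Fin (S i).numVar) fun g => (X ⟶ (S g.1).varSort g.2)

/-- The action of `r : X ⟶ Y` on the free module: precomposition. -/
def freeMap {X Y : C} (r : X ⟶ Y) : Free S Y →+ Free S X :=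
  DirectSum.map fun _ => Preadditive.leftComp _ r

open Classical in
@[simp]
lemma freeMap_of {X Y : C} (r : X ⟶ Y) (g : Σ i, Fin (S i).numVar) (x : Y ⟶ (S g.1).varSort g.2) :
    freeMap S r (DirectSum.of (fun g => (Y ⟶ (S g.1).varSort g.2)) g x) =
      DirectSum.of (fun g => (X ⟶ (S g.1).varSort g.2)) g (r ≫ x) :=
  DirectSum.map_of _ _ _

/-- The action of `r : X ⟶ Y` on the direct sum of `A` and the free module. -/
def extMap {X Y : C} (r : X ⟶ Y) : A.obj (op Y) × Free S Y →+ A.obj (op X) × Free S X :=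
  (A.map r.op).hom.prodMap (freeMap S r)

lemma freeMap_id (X : C) : freeMap S (𝟙 X) = AddMonoidHom.id _ := by
  classical
  refine DirectSum.addHom_ext fun g x => ?_
  simp

lemma freeMap_comp {X Y Z : C} (r : X ⟶ Y) (r' : Y ⟶ Z) :
    freeMap S (r ≫ r') = (freeMap S r).comp (freeMap S r') := by
  classical
  refine DirectSum.addHom_ext fun g x => ?_
  simp

lemma extMap_id (X : C) : extMap A S (𝟙 X) = AddMonoidHom.id _ := by
  ext x <;> simp [extMap, freeMap_id]

lemma extMap_comp {X Y Z : C} (r : X ⟶ Y) (r' : Y ⟶ Z) :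
    extMap A S (r ≫ r') = (extMap A S r).comp (extMap A S r') := by
  ext x <;> simp [extMap, freeMap_comp]

open Classical in
/-- The element of `A ⊕ Free S` that has to vanish for the new generators to solve the `j`-th
equation of the `i`-th system. -/
noncomputable def relator (i : I) (j : Fin (S i).numEq) :
    A.obj (op ((S i).eqSort j)) × Free S ((S i).eqSort j) :=
  (t i j, ∑ k, DirectSum.of (fun g : Σ i, Fin (S i).numVar => (_ ⟶ (S g.1).varSort g.2)) ⟨i, k⟩
    ((S i).coeff k j))

/-- The submodule generated by the relators, at the object `X`. -/
def relations (X : C) : AddSubgroup (A.obj (op X) × Free S X) :=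
  AddSubgroup.closure {z | ∃ i j, ∃ r : X ⟶ (S i).eqSort j, extMap A S r (relator A S t i j) = z}

lemma relations_le_comap {X Y : C} (r : X ⟶ Y) :
    relations A S t Y ≤ (relations A S t X).comap (extMap A S r) := by
  refine (AddSubgroup.closure_le _).2 ?_
  rintro _ ⟨i, j, r', rfl⟩
  refine AddSubgroup.subset_closure ⟨i, j, r ≫ r', ?_⟩
  rw [extMap_comp]; rfl

end Adjoin

open Adjoin

variable [Preadditive C] (A : Cᵒᵖ ⥤ AddCommGrpCat.{max u v w}) {I : Type (max u v w)}
  (S : I → FinSystem C) (t : ∀ i j, A.obj (op ((S i).eqSort j)))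

/-- The module obtained from `A` by freely adjoining, for each `i`, a solution of the system `S i`
with constant terms `t i`. Repeated systems get independent solutions. -/
noncomputable def adjoin : Cᵒᵖ ⥤ AddCommGrpCat.{max u v w} where
  obj X := AddCommGrpCat.of ((A.obj X × Free S X.unop) ⧸ relations A S t X.unop)
  map r := AddCommGrpCat.ofHom
    (QuotientAddGroup.map _ _ (extMap A S r.unop) (relations_le_comap A S t r.unop))
  map_id X := by
    refine ConcreteCategory.hom_ext _ _ fun x => ?_
    induction x using QuotientAddGroup.induction_on with
    | H z =>
      refine congrArg (QuotientAddGroup.mk (s := relations A S t X.unop)) ?_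
      exact DFunLike.congr_fun (extMap_id A S X.unop) z
  map_comp {X Y Z} r r' := by
    refine ConcreteCategory.hom_ext _ _ fun x => ?_
    induction x using QuotientAddGroup.induction_on with
    | H z =>
      refine congrArg (QuotientAddGroup.mk (s := relations A S t Z.unop)) ?_
      exact DFunLike.congr_fun (extMap_comp A S r'.unop r.unop) z

namespace Adjoin

/-- The quotient map of the presentation of `adjoin A S t`. -/
noncomputable def mk (X : C) : A.obj (op X) × Free S X →+ (adjoin A S t).obj (op X) :=
  QuotientAddGroup.mk' (relations A S t X)

lemma mk_surjective (X : C) : Function.Surjective (mk A S t X) :=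
  QuotientAddGroup.mk'_surjective _

lemma map_mk {X Y : C} (r : X ⟶ Y) (z : A.obj (op Y) × Free S Y) :
    (adjoin A S t).map r.op (mk A S t Y z) = mk A S t X (extMap A S r z) := rfl

/-- The structure map `A ⟶ adjoin A S t`; it need not be injective. -/
noncomputable def incl : A ⟶ adjoin A S t where
  app X := AddCommGrpCat.ofHom ((mk A S t X.unop).comp (AddMonoidHom.inl _ _))
  naturality X Y r := by
    ext x
    refine congrArg (mk A S t Y.unop) (Prod.ext rfl ?_)
    exact (map_zero (freeMap S r.unop)).symm

lemma incl_app {X : C} (a : A.obj (op X)) : (incl A S t).app (op X) a = mk A S t X (a, 0) := rfl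

open Classical in
/-- The adjoined solution of the `i`-th system. -/
noncomputable def gen (i : I) (k : Fin (S i).numVar) : (adjoin A S t).obj (op ((S i).varSort k)) :=
  mk A S t _ (0, DirectSum.of (fun g : Σ i, Fin (S i).numVar => (_ ⟶ (S g.1).varSort g.2))
    ⟨i, k⟩ (𝟙 _))

open Classical in
lemma map_gen {X : C} (i : I) (k : Fin (S i).numVar) (r : X ⟶ (S i).varSort k) :
    (adjoin A S t).map r.op (gen A S t i k) =
      mk A S t _ (0, DirectSum.of (fun g : Σ i, Fin (S i).numVar => (_ ⟶ (S g.1).varSort g.2))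
        ⟨i, k⟩ r) := by
  rw [gen, map_mk]
  congr 1
  refine Prod.ext (map_zero (A.map r.op).hom) ?_
  exact (freeMap_of S r ⟨i, k⟩ (𝟙 _)).trans (by rw [Category.comp_id])

lemma solves_gen (i : I) :
    (S i).Solves (adjoin A S t) (fun j => (incl A S t).app _ (t i j)) (gen A S t i) := by
  classical
  intro j
  have h : mk A S t _ (relator A S t i j) = 0 := by
    refine (QuotientAddGroup.eq_zero_iff _).2 (AddSubgroup.subset_closure ⟨i, j, 𝟙 _, ?_⟩)
    rw [extMap_id]; rfl
  rw [← h]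
  simp only [map_gen, incl_app, ← map_sum, ← map_add]
  congr 1
  refine Prod.ext ?_ ?_
  · simp [relator, Prod.fst_sum]
  · simp [relator, Prod.snd_sum]

/-- Elements of `adjoin A S t` are sums of an element of `A` and linear terms in finitely many
adjoined solutions. The set of systems used may be enlarged, so that a finite family has a common
one. -/
lemma exists_rep {X : C} (x : (adjoin A S t).obj (op X)) :
    ∃ (a : A.obj (op X)) (r : ∀ i (k : Fin (S i).numVar), X ⟶ (S i).varSort k) (T₀ : Finset I),
      ∀ T, T₀ ⊆ T → x = (incl A S t).app _ a +
        ∑ i ∈ T, ∑ k, (adjoin A S t).map (r i k).op (gen A S t i k) := by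
  classical
  obtain ⟨⟨a, w⟩, rfl⟩ := mk_surjective A S t X x
  suffices h : ∃ (r : ∀ i (k : Fin (S i).numVar), X ⟶ (S i).varSort k) (T₀ : Finset I),
      ∀ T, T₀ ⊆ T → mk A S t X (0, w) =
        ∑ i ∈ T, ∑ k, (adjoin A S t).map (r i k).op (gen A S t i k) by
    obtain ⟨r, T₀, h⟩ := h
    refine ⟨a, r, T₀, fun T hT => ?_⟩
    rw [← h T hT, incl_app, ← map_add]
    simp
  simp only [map_gen]
  induction w using DirectSum.induction_on with
  | zero => exact ⟨fun _ _ => 0, ∅, fun T _ => by simp [← Prod.zero_eq_mk]⟩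
  | of g r =>
    obtain ⟨i, k⟩ := g
    refine ⟨fun i' k' => if h : (⟨i, k⟩ : Σ i, Fin (S i).numVar) = ⟨i', k'⟩
      then r ≫ eqToHom (by cases h; rfl) else 0, {i}, fun T hT => ?_⟩
    rw [Finset.sum_eq_single_of_mem i (hT (Finset.mem_singleton_self i)),
      Finset.sum_eq_single_of_mem k (Finset.mem_univ k)]
    · simp
    · intro k' _ hk
      simp [hk.symm, ← Prod.zero_eq_mk]
    · intro i' _ hi
      refine Finset.sum_eq_zero fun k' _ => ?_
      simp [hi.symm, ← Prod.zero_eq_mk]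
  | add w w' ih ih' =>
    obtain ⟨r, T₀, h⟩ := ih
    obtain ⟨r', T₀', h'⟩ := ih'
    refine ⟨fun i k => r i k + r' i k, T₀ ∪ T₀', fun T hT => ?_⟩
    have e : ((0, w + w') : A.obj (op X) × Free S X) = (0, w) + (0, w') := by simp
    rw [e, map_add, h T (Finset.union_subset_left hT), h' T (Finset.union_subset_right hT),
      ← Finset.sum_add_distrib]
    refine Finset.sum_congr rfl fun i _ => ?_
    rw [← Finset.sum_add_distrib]
    refine Finset.sum_congr rfl fun k _ => ?_
    rw [← map_add]
    simp

instance [A.Additive] : (adjoin A S t).Additive where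
  map_add {X Y r r'} := by
    classical
    ext x
    obtain ⟨⟨a, w⟩, rfl⟩ := mk_surjective A S t X.unop x
    refine (congrArg (mk A S t Y.unop) (?_ : _ = extMap A S r.unop (a, w) +
      extMap A S r'.unop (a, w))).trans (map_add _ _ _)
    refine Prod.ext ?_ ?_
    · change A.map (r + r') a = A.map r a + A.map r' a
      rw [Functor.map_add]; rfl
    · change freeMap S (r.unop + r'.unop) w = (freeMap S r.unop + freeMap S r'.unop) w
      congr 1
      refine DirectSum.addHom_ext fun g x => ?_
      simp

variable {A} {N : Cᵒᵖ ⥤ AddCommGrpCat.{max u v w}} [N.Additive]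

open Classical in
/-- The map out of the free module that sends the generators to `y`. -/
noncomputable def freeLift (y : ∀ i (k : Fin (S i).numVar), N.obj (op ((S i).varSort k))) (X : C) :
    Free S X →+ N.obj (op X) :=
  DirectSum.toAddMonoid fun g =>
    { toFun := fun r => N.map r.op (y g.1 g.2)
      map_zero' := by simp
      map_add' := fun r r' => by simp [Functor.map_add] }

lemma freeLift_freeMap (y : ∀ i (k : Fin (S i).numVar), N.obj (op ((S i).varSort k))) {X Y : C}
    (r : X ⟶ Y) (w : Free S Y) :
    freeLift S y X (freeMap S r w) = N.map r.op (freeLift S y Y w) := by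
  classical
  refine DFunLike.congr_fun (f := (freeLift S y X).comp (freeMap S r))
    (g := (N.map r.op).hom.comp (freeLift S y Y)) (DirectSum.addHom_ext fun g x => ?_) w
  simp [freeLift]

/-- The universal property of `adjoin A S t`. -/
lemma exists_lift (h : A ⟶ N) (y : ∀ i (k : Fin (S i).numVar), N.obj (op ((S i).varSort k)))
    (hy : ∀ i, (S i).Solves N (fun j => h.app _ (t i j)) (y i)) :
    ∃ h' : adjoin A S t ⟶ N, incl A S t ≫ h' = h ∧
      ∀ i k, h'.app _ (gen A S t i k) = y i k := by
  classical
  let l (X : C) : A.obj (op X) × Free S X →+ N.obj (op X) :=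
    (h.app (op X)).hom.coprod (freeLift S y X)
  have hl {X Y : C} (r : X ⟶ Y) (z) : l X (extMap A S r z) = N.map r.op (l Y z) := by
    refine (congrArg₂ (· + ·) (NatTrans.naturality_apply h r.op z.1)
      (freeLift_freeMap S y r z.2)).trans (map_add (N.map r.op).hom _ _).symm
  have hk (X : C) : relations A S t X ≤ (l X).ker := by
    refine (AddSubgroup.closure_le _).2 ?_
    rintro _ ⟨i, j, r, rfl⟩
    have : l _ (relator A S t i j) = 0 := by
      simpa [l, relator, freeLift, map_sum] using hy i j
    change l X _ = 0
    rw [hl, this, map_zero]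
  refine ⟨{ app := fun X => AddCommGrpCat.ofHom (QuotientAddGroup.lift _ (l X.unop) (hk X.unop))
            naturality := fun X Y r => ?_ }, ?_, fun i k => ?_⟩
  · ext x
    obtain ⟨z, rfl⟩ := mk_surjective A S t X.unop x
    exact hl r.unop z
  · ext X a
    change l X.unop (a, 0) = _
    simp [l]
  · change l _ (0, _) = _
    simp [l, freeLift]

end Adjoin

end

/-! ### pp formulas and pure epimorphisms -/

section

variable {C : Type u} [Category.{v} C]

namespace PPFormula

variable {n : ℕ} {σ : Fin n → C}

/-- The constant terms of the system that a witness of `φ(a)` has to solve. -/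
def freePart (φ : PPFormula σ) (N : Cᵒᵖ ⥤ AddCommGrpCat.{w}) (a : ∀ i, N.obj (op (σ i)))
    (j : Fin φ.numEq) : N.obj (op (φ.eqSort j)) :=
  ∑ i, N.map (φ.freeCoeff i j).op (a i)

/-- The system of equations of `φ`, in its bound variables. -/
abbrev boundSystem (φ : PPFormula σ) : FinSystem C where
  numVar := φ.numBound
  varSort := φ.boundSort
  numEq := φ.numEq
  eqSort := φ.eqSort
  coeff := φ.boundCoeff

lemma mem_sol_iff (φ : PPFormula σ) (N : Cᵒᵖ ⥤ AddCommGrpCat.{w}) (a : ∀ i, N.obj (op (σ i))) :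
    a ∈ φ.sol N ↔ ∃ b, φ.boundSystem.Solves N (φ.freePart N a) b :=
  Iff.rfl

lemma freePart_map (φ : PPFormula σ) {N N' : Cᵒᵖ ⥤ AddCommGrpCat.{w}} (f : N ⟶ N')
    (a : ∀ i, N.obj (op (σ i))) (j : Fin φ.numEq) :
    f.app _ (φ.freePart N a j) = φ.freePart N' (fun i => f.app _ (a i)) j := by
  simp [freePart, map_sum, NatTrans.naturality_apply]

lemma map_mem_sol {φ : PPFormula σ} {N N' : Cᵒᵖ ⥤ AddCommGrpCat.{w}} (f : N ⟶ N')
    {a : ∀ i, N.obj (op (σ i))} (ha : a ∈ φ.sol N) : (fun i => f.app _ (a i)) ∈ φ.sol N' := by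
  obtain ⟨b, hb⟩ := (φ.mem_sol_iff N a).1 ha
  refine (φ.mem_sol_iff N' _).2 ⟨fun k => f.app _ (b k), ?_⟩
  simpa only [freePart_map] using hb.map f

/-- The matrix `-1` on the sorts `σ`: it moves `xᵢ` to the other side of an equation. -/
def negDelta [Preadditive C] (σ : Fin n → C) (i' i : Fin n) : σ i' ⟶ σ i :=
  if h : i' = i then -eqToHom (congrArg σ h) else 0

lemma sum_map_negDelta [Preadditive C] (N : Cᵒᵖ ⥤ AddCommGrpCat.{w}) [N.Additive]
    (x : ∀ i, N.obj (op (σ i))) (i : Fin n) :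
    ∑ i', N.map (negDelta σ i i').op (x i') = -x i := by
  rw [Finset.sum_eq_single_of_mem i (Finset.mem_univ i) fun i' _ hi => ?_]
  · simp [negDelta, Functor.map_neg]
  · simp [negDelta, hi.symm]

/-- The formula `∃ y, ⋀ⱼ ∑ₖ yₖ coeffₖⱼ = 0 ∧ ⋀ᵢ xᵢ = ∑ₖ yₖ termₖᵢ`, with arbitrary finite index
types for the variables `y` and the equations. -/
noncomputable def image [Preadditive C] {κ τ : Type*} [Fintype κ] [Fintype τ] (s : κ → C)
    (e : τ → C) (coeff : ∀ k j, e j ⟶ s k) (term : ∀ k i, σ i ⟶ s k) : PPFormula σ where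
  numBound := Fintype.card κ
  boundSort k := s ((Fintype.equivFin κ).symm k)
  numEq := Fintype.card (τ ⊕ Fin n)
  eqSort j := Sum.elim e σ ((Fintype.equivFin (τ ⊕ Fin n)).symm j)
  freeCoeff i j := match (Fintype.equivFin (τ ⊕ Fin n)).symm j with
    | .inl _ => 0
    | .inr i' => negDelta σ i' i
  boundCoeff k j := match (Fintype.equivFin (τ ⊕ Fin n)).symm j with
    | .inl j' => coeff ((Fintype.equivFin κ).symm k) j'
    | .inr i => term ((Fintype.equivFin κ).symm k) i

lemma mem_sol_image [Preadditive C] {κ τ : Type*} [Fintype κ] [Fintype τ] (s : κ → C)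
    (e : τ → C) (coeff : ∀ k j, e j ⟶ s k) (term : ∀ k i, σ i ⟶ s k)
    (N : Cᵒᵖ ⥤ AddCommGrpCat.{w}) [N.Additive] (x : ∀ i, N.obj (op (σ i))) :
    x ∈ (image s e coeff term).sol N ↔ ∃ y : ∀ k, N.obj (op (s k)),
      (∀ j, ∑ k, N.map (coeff k j).op (y k) = 0) ∧
        ∀ i, x i = ∑ k, N.map (term k i).op (y k) := by
  classical
  let E := Fintype.equivFin κ
  let E' := Fintype.equivFin (τ ⊕ Fin n)
  have key (y : ∀ k, N.obj (op (s k))) :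
      (image s e coeff term).boundSystem.Solves N ((image s e coeff term).freePart N x)
        (fun k => y (E.symm k)) ↔
      (∀ j, ∑ k, N.map (coeff k j).op (y k) = 0) ∧
        ∀ i, x i = ∑ k, N.map (term k i).op (y k) := by
    let fc (i : Fin n) (q : τ ⊕ Fin n) : Sum.elim e σ q ⟶ σ i := match q with
      | .inl _ => 0
      | .inr i' => negDelta σ i' i
    let bc (k : κ) (q : τ ⊕ Fin n) : Sum.elim e σ q ⟶ s k := match q with
      | .inl j => coeff k j
      | .inr i => term k i
    have h1 : (image s e coeff term).boundSystem.Solves N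
        ((image s e coeff term).freePart N x) (fun k => y (E.symm k)) ↔
        ∀ q : τ ⊕ Fin n, ∑ i, N.map (fc i q).op (x i) + ∑ k, N.map (bc k q).op (y k) = 0 := by
      rw [← E'.symm.forall_congr_right]
      refine forall_congr' fun j => ?_
      rw [← E.symm.sum_comp]
      exact Iff.rfl
    rw [h1, Sum.forall]
    refine and_congr (forall_congr' fun j => ?_) (forall_congr' fun i => ?_)
    · have h0 (i) : N.map (fc i (.inl j)).op (x i) = 0 :=
        show N.map (0 : e j ⟶ σ i).op (x i) = 0 by simp
      rw [Finset.sum_eq_zero fun i _ => h0 i, zero_add]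
      exact Iff.rfl
    · have h0 : ∑ i', N.map (fc i' (.inr i)).op (x i') = (-x i : N.obj (op (σ i))) :=
        sum_map_negDelta N x i
      rw [h0]
      exact neg_add_eq_zero (a := x i)
  rw [mem_sol_iff]
  constructor
  · rintro ⟨b, hb⟩
    obtain ⟨y, rfl⟩ : ∃ y : ∀ k, N.obj (op (s k)), b = fun k => y (E.symm k) := by
      obtain ⟨y, hy⟩ := (Equiv.piCongrLeft' (fun k => N.obj (op (s k))) E).surjective b
      exact ⟨y, hy.symm⟩
    exact ⟨y, (key y).1 hb⟩
  · rintro ⟨y, hy⟩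
    exact ⟨_, (key y).2 hy⟩

end PPFormula

section Kernel

variable {P M : Cᵒᵖ ⥤ AddCommGrpCat.{w}} (π : P ⟶ M)

lemma app_surjective_of_epi [Epi π] (X : Cᵒᵖ) : Function.Surjective (π.app X) :=
  (AddCommGrpCat.epi_iff_surjective _).1 inferInstance

lemma kernel_ι_app_injective (X : Cᵒᵖ) : Function.Injective ((Limits.kernel.ι π).app X) :=
  (AddCommGrpCat.mono_iff_injective _).1 inferInstance

lemma app_kernel_ι_app {X : Cᵒᵖ} (z : (Limits.kernel π).obj X) :
    π.app X ((Limits.kernel.ι π).app X z) = 0 := by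
  exact congrArg (fun f => f.app X z) (Limits.kernel.condition π)

lemma exists_kernel_ι_app_eq {X : Cᵒᵖ} {x : P.obj X} (hx : π.app X x = 0) :
    ∃ z, (Limits.kernel.ι π).app X z = x := by
  have h := (ShortComplex.exact_kernel π).map ((evaluation _ _).obj X)
  exact (ShortComplex.ab_exact_iff _).1 h x hx

end Kernel

lemma isPureMono_iff {K P : Cᵒᵖ ⥤ AddCommGrpCat.{w}} (f : K ⟶ P) :
    IsPureMono f ↔ ∀ (n : ℕ) (σ : Fin n → C) (φ : PPFormula σ) (a : ∀ i, K.obj (op (σ i))),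
      (fun i => f.app _ (a i)) ∈ φ.sol P → a ∈ φ.sol K := by
  refine ⟨fun h n σ φ a ha => ?_, fun h n σ a => ?_⟩
  · have := h n σ a
    exact (this ▸ ha : φ ∈ ppType K a)
  · exact Set.Subset.antisymm (fun φ hφ => PPFormula.map_mem_sol f hφ) fun φ hφ => h n σ φ a hφ

/-- A morphism is a pure epimorphism if solutions of finite homogeneous systems lift along it. -/
lemma IsPureEpi.of_lift {P M : Cᵒᵖ ⥤ AddCommGrpCat.{w}} (π : P ⟶ M)
    (h : ∀ (S : FinSystem C) (y : ∀ k, M.obj (op (S.varSort k))), S.Solves M (fun _ => 0) y →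
      ∃ x, S.Solves P (fun _ => 0) x ∧ ∀ k, π.app _ (x k) = y k) : IsPureEpi π := by
  constructor
  · rw [NatTrans.epi_iff_epi_app]
    intro X
    rw [AddCommGrpCat.epi_iff_surjective]
    intro y
    obtain ⟨x, -, hx⟩ := h ⟨1, fun _ => X.unop, 0, Fin.elim0, fun _ j => j.elim0⟩ (fun _ => y)
      (fun j => j.elim0)
    exact ⟨x 0, hx 0⟩
  · rw [isPureMono_iff]
    intro n σ φ a ha
    obtain ⟨b, hb⟩ := (φ.mem_sol_iff P _).1 ha
    have e (j) : π.app _ (φ.freePart P (fun i => (Limits.kernel.ι π).app _ (a i)) j) = 0 := by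
      rw [← φ.freePart_map, app_kernel_ι_app]
    obtain ⟨x, hx, hxb⟩ := h φ.boundSystem (fun k => π.app _ (b k)) (by
      have := hb.map π
      simpa only [e] using this)
    -- `b` and `x` have the same image in `M`, so `b - x` lies in the kernel and witnesses `φ(a)`
    choose z hz using fun k => exists_kernel_ι_app_eq π (x := b k - x k) (by
      rw [map_sub, hxb, sub_self])
    refine (φ.mem_sol_iff _ a).2 ⟨z, fun j => kernel_ι_app_injective π _ ?_⟩
    have h1 := hb j
    have h2 := hx j
    rw [map_add, φ.freePart_map, map_sum, map_zero]
    simp only [NatTrans.naturality_apply, hz, map_sub, Finset.sum_sub_distrib]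
    rw [zero_add] at h2
    rw [h2, sub_zero]
    exact h1

/-- Solutions of pp formulas lift along pure epimorphisms: lift the variables arbitrarily, then use
purity of the kernel to correct the error terms of the equations. -/
lemma IsPureEpi.exists_lift [Preadditive C] {P M : Cᵒᵖ ⥤ AddCommGrpCat.{w}} [P.Additive]
    {π : P ⟶ M} (hπ : IsPureEpi π) {n : ℕ} {σ : Fin n → C} {φ : PPFormula σ}
    {a : ∀ i, M.obj (op (σ i))} (ha : a ∈ φ.sol M) :
    ∃ b ∈ φ.sol P, ∀ i, π.app _ (b i) = a i := by
  obtain ⟨hepi, hpure⟩ := hπ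
  have hK : (Limits.kernel π).Additive := ⟨fun {X Y r r'} => by
    ext z
    apply kernel_ι_app_injective π
    simp [NatTrans.naturality_apply, Functor.map_add]⟩
  obtain ⟨y, hy⟩ := (φ.mem_sol_iff M a).1 ha
  choose a' ha' using fun i => app_surjective_of_epi π _ (a i)
  choose y' hy' using fun k => app_surjective_of_epi π _ (y k)
  -- the error terms of the lifted equations lie in the kernel
  choose z hz using fun j => exists_kernel_ι_app_eq π
    (x := φ.freePart P a' j + ∑ k, P.map (φ.boundCoeff k j).op (y' k)) (by
      have h := hy j
      simp only [PPFormula.freePart, ← ha', ← hy', PPFormula.boundSystem] at h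
      simpa [PPFormula.freePart, map_sum, NatTrans.naturality_apply] using h)
  -- `θ` says of the error terms that they are errors of some tuple
  let s : Fin n ⊕ Fin φ.numBound → C := Sum.elim σ φ.boundSort
  let u (k : Fin n ⊕ Fin φ.numBound) (j : Fin φ.numEq) : φ.eqSort j ⟶ s k := match k with
    | .inl i => φ.freeCoeff i j
    | .inr k => φ.boundCoeff k j
  let θ : PPFormula φ.eqSort := .image s Empty.elim (fun _ j => j.elim) u
  have hθ : (fun j => (Limits.kernel.ι π).app _ (z j)) ∈ θ.sol P := by
    rw [PPFormula.mem_sol_image]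
    refine ⟨fun k => match k with
      | .inl i => a' i
      | .inr k => y' k, fun j => j.elim, fun j => ?_⟩
    rw [hz, Fintype.sum_sum_type]
    rfl
  obtain ⟨x, -, hx⟩ := (PPFormula.mem_sol_image _ _ _ _ _ _).1
    ((isPureMono_iff _).1 hpure _ _ _ _ hθ)
  let x₁ (i : Fin n) : (Limits.kernel π).obj (op (σ i)) := x (.inl i)
  let x₂ (k : Fin φ.numBound) : (Limits.kernel π).obj (op (φ.boundSort k)) := x (.inr k)
  have hx' (j) : z j =
      φ.freePart _ x₁ j + ∑ k, (Limits.kernel π).map (φ.boundCoeff k j).op (x₂ k) :=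
    (hx j).trans (Fintype.sum_sum_type _)
  refine ⟨fun i => a' i - (Limits.kernel.ι π).app _ (x₁ i), ⟨fun k => y' k -
    (Limits.kernel.ι π).app _ (x₂ k), fun j => ?_⟩, fun i => ?_⟩
  · have h1 := hz j
    rw [hx', map_add, map_sum, φ.freePart_map] at h1
    simp only [NatTrans.naturality_apply, PPFormula.freePart] at h1
    simp only [map_sub, Finset.sum_sub_distrib]
    rw [sub_add_sub_comm, sub_eq_zero]
    exact h1.symm
  · rw [map_sub, app_kernel_ι_app, sub_zero, ha']

end

/-! ### Locally generic modules -/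

section

variable {C : Type u} [Category.{v} C]

lemma map_zero_op [Preadditive C] (N : Cᵒᵖ ⥤ AddCommGrpCat.{w}) [N.Additive] {X Y : C}
    (x : N.obj (op Y)) : N.map (0 : X ⟶ Y).op x = 0 := by
  simp

lemma app_sum_map {A N : Cᵒᵖ ⥤ AddCommGrpCat.{w}} (f : A ⟶ N) {κ : Type*} [Fintype κ] {s : κ → C}
    {X : C} (t : ∀ k, X ⟶ s k) (y : ∀ k, A.obj (op (s k))) :
    f.app _ (∑ k, A.map (t k).op (y k)) = ∑ k, N.map (t k).op (f.app _ (y k)) := by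
  simp [map_sum, NatTrans.naturality_apply]

/-- `y` is a solution in `A` of the homogeneous system `coeff`, and every solution in a module of
`D` is the image of `y` under some morphism from `A`. Equivalently, the induced map from the
finitely presented module defined by `coeff` to `A` is one along which all morphisms to `D` extend.
-/
def IsGenericSolution (D : ObjectProperty (Cᵒᵖ ⥤ AddCommGrpCat.{w}))
    {A : Cᵒᵖ ⥤ AddCommGrpCat.{w}} {κ τ : Type*} [Fintype κ] {s : κ → C} {e : τ → C}
    (coeff : ∀ k j, e j ⟶ s k) (y : ∀ k, A.obj (op (s k))) : Prop :=
  (∀ j, ∑ k, A.map (coeff k j).op (y k) = 0) ∧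
    ∀ N, D N → ∀ z : ∀ k, N.obj (op (s k)), (∀ j, ∑ k, N.map (coeff k j).op (z k) = 0) →
      ∃ f : A ⟶ N, ∀ k, f.app _ (y k) = z k

/-- Every finite tuple of `A` consists of linear terms in a generic solution of a finite homogeneous
system. For `A` in `D` this makes `A` strictly `D`-atomic, but it is meaningful for every `A`, and
the stages of the construction below need not lie in `D`. Arbitrary finite index types avoid
renumberings. -/
def IsLocallyGeneric (D : ObjectProperty (Cᵒᵖ ⥤ AddCommGrpCat.{w}))
    (A : Cᵒᵖ ⥤ AddCommGrpCat.{w}) : Prop :=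
  ∀ (ι : Type w) [Finite ι] (σ : ι → C) (a : ∀ i, A.obj (op (σ i))),
    ∃ (κ τ : Type w) (_ : Fintype κ) (_ : Fintype τ) (s : κ → C) (e : τ → C)
      (coeff : ∀ k j, e j ⟶ s k) (y : ∀ k, A.obj (op (s k))) (term : ∀ k i, σ i ⟶ s k),
      IsGenericSolution D coeff y ∧ ∀ i, a i = ∑ k, A.map (term k i).op (y k)

section Block

variable {T : Type*} (S : T → FinSystem C)

open Classical in
/-- The coefficients of the disjoint union of a family of systems: a block diagonal matrix. -/
noncomputable def FinSystem.blockCoeff [Preadditive C] (k : Σ c, Fin (S c).numVar)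
    (j : Σ c, Fin (S c).numEq) : (S j.1).eqSort j.2 ⟶ (S k.1).varSort k.2 :=
  if h : k.1 = j.1 then (S j.1).coeff (h ▸ k.2) j.2 ≫ eqToHom (by
    obtain ⟨c, k⟩ := k; obtain ⟨c', j⟩ := j; cases h; rfl) else 0

lemma FinSystem.sum_map_blockCoeff [Preadditive C] [Fintype T] (N : Cᵒᵖ ⥤ AddCommGrpCat.{w})
    [N.Additive] (z : ∀ k : Σ c, Fin (S c).numVar, N.obj (op ((S k.1).varSort k.2)))
    (j : Σ c, Fin (S c).numEq) :
    ∑ k, N.map (FinSystem.blockCoeff S k j).op (z k) =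
      ∑ k, N.map ((S j.1).coeff k j.2).op (z ⟨j.1, k⟩) := by
  rw [Fintype.sum_sigma, Finset.sum_eq_single_of_mem j.1 (Finset.mem_univ _) fun c _ hc => ?_]
  · simp [blockCoeff]
  · refine Finset.sum_eq_zero fun k _ => ?_
    simp [blockCoeff, hc]

end Block

/-- A finite system over `A`, solvable along every morphism from `A` to a module of `D`, with a
chosen solution in `M` along `g`. -/
structure Cell (D : ObjectProperty (Cᵒᵖ ⥤ AddCommGrpCat.{w})) {A M : Cᵒᵖ ⥤ AddCommGrpCat.{w}}
    (g : A ⟶ M) where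
  sys : FinSystem C
  const : ∀ j, A.obj (op (sys.eqSort j))
  solvable : ∀ N, D N → ∀ h : A ⟶ N, ∃ y, sys.Solves N (fun j => h.app _ (const j)) y
  sol : ∀ k, M.obj (op (sys.varSort k))
  solves_sol : sys.Solves M (fun j => g.app _ (const j)) sol

section Step

variable [Preadditive C] {D : ObjectProperty (Cᵒᵖ ⥤ AddCommGrpCat.{max u v w})}
  {A M : Cᵒᵖ ⥤ AddCommGrpCat.{max u v w}} (g : A ⟶ M)

/-- The module obtained from `A` by adjoining a solution for each cell over `g`. -/
noncomputable abbrev extension (D : ObjectProperty (Cᵒᵖ ⥤ AddCommGrpCat.{max u v w}))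
    {A M : Cᵒᵖ ⥤ AddCommGrpCat.{max u v w}} (g : A ⟶ M) : Cᵒᵖ ⥤ AddCommGrpCat.{max u v w} :=
  adjoin A (fun c : Cell D g => c.sys) Cell.const

/-- The structure map from `A` to its extension. -/
noncomputable abbrev extensionIncl (D : ObjectProperty (Cᵒᵖ ⥤ AddCommGrpCat.{max u v w}))
    {A M : Cᵒᵖ ⥤ AddCommGrpCat.{max u v w}} (g : A ⟶ M) : A ⟶ extension D g :=
  Adjoin.incl A (fun c : Cell D g => c.sys) Cell.const

/-- A morphism from `A` to a module of `D` extends to the extension, with prescribed values on any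
set of cells: the other cells are solvable in `N` by definition. -/
lemma exists_extension_desc (hD : ∀ N, D N → N.Additive)
    {N : Cᵒᵖ ⥤ AddCommGrpCat.{max u v w}} (hN : D N) (h : A ⟶ N)
    (T : Set (Cell D g)) (y : ∀ (c : T) k, N.obj (op (c.1.sys.varSort k)))
    (hy : ∀ c : T, c.1.sys.Solves N (fun j => h.app _ (c.1.const j)) (y c)) :
    ∃ h' : extension D g ⟶ N, extensionIncl D g ≫ h' = h ∧
      ∀ (c : T) k,
        h'.app _ (Adjoin.gen A (fun c : Cell D g => c.sys) Cell.const c.1 k) = y c k := by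
  classical
  have := hD N hN
  choose y₀ hy₀ using fun c : Cell D g => c.solvable N hN h
  obtain ⟨h', h₁, h₂⟩ := Adjoin.exists_lift (fun c : Cell D g => c.sys) Cell.const h
    (fun c => if hc : c ∈ T then y ⟨c, hc⟩ else y₀ c) (fun c => by
      by_cases hc : c ∈ T
      · simpa [hc] using hy ⟨c, hc⟩
      · simpa [hc] using hy₀ c)
  exact ⟨h', h₁, fun c k => by simp [h₂]⟩

lemma exists_extension_comp_eq (hD : ∀ N, D N → N.Additive)
    {N : Cᵒᵖ ⥤ AddCommGrpCat.{max u v w}} (hN : D N) (h : A ⟶ N) :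
    ∃ h' : extension D g ⟶ N, extensionIncl D g ≫ h' = h := by
  obtain ⟨h', e, -⟩ := exists_extension_desc g hD hN h ∅ (fun c => c.2.elim) (fun c => c.2.elim)
  exact ⟨h', e⟩

lemma exists_extensionDesc [M.Additive] : ∃ g' : extension D g ⟶ M, extensionIncl D g ≫ g' = g ∧
      ∀ (c : Cell D g) k,
        g'.app _ (Adjoin.gen A (fun c : Cell D g => c.sys) Cell.const c k) = c.sol k :=
  Adjoin.exists_lift _ _ g _ fun c => c.solves_sol

/-- The extension of `g` that sends the adjoined solutions to the chosen solutions in `M`. -/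
noncomputable def extensionDesc [M.Additive] : extension D g ⟶ M :=
  (exists_extensionDesc g).choose

lemma extensionIncl_desc [M.Additive] : extensionIncl D g ≫ extensionDesc g = g :=
  (exists_extensionDesc g).choose_spec.1

lemma exists_solves_extension [M.Additive] (c : Cell D g) :
    ∃ y, c.sys.Solves (extension D g) (fun j => (extensionIncl D g).app _ (c.const j)) y ∧
      ∀ k, (extensionDesc g).app _ (y k) = c.sol k :=
  ⟨_, Adjoin.solves_gen A (fun c : Cell D g => c.sys) Cell.const c,
    (exists_extensionDesc g).choose_spec.2 c⟩

/-- A tuple of the extension involves only finitely many cells. Apply the hypothesis to its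
components in `A` together with the constant terms of these cells, and join the resulting generic
solution with the adjoined solutions of these cells. -/
lemma IsLocallyGeneric.extension [A.Additive] (hD : ∀ N, D N → N.Additive)
    (hA : IsLocallyGeneric D A) :
    IsLocallyGeneric D (extension D g) := by
  classical
  intro ι _ σ x
  have := Fintype.ofFinite ι
  choose a r T₀ hT₀ using fun i => Adjoin.exists_rep A (fun c : Cell D g => c.sys) Cell.const (x i)
  let T : Finset (Cell D g) := Finset.univ.biUnion T₀
  have hT (i) := hT₀ i T (Finset.subset_biUnion_of_mem T₀ (Finset.mem_univ i))
  let J : Type (max u v w) := Σ c : T, Fin c.1.sys.numEq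
  let K : Type (max u v w) := Σ c : T, Fin c.1.sys.numVar
  let σ' : ι ⊕ J → C := Sum.elim σ fun j => j.1.1.sys.eqSort j.2
  let b (q : ι ⊕ J) : A.obj (op (σ' q)) := match q with
    | .inl i => a i
    | .inr j => j.1.1.const j.2
  obtain ⟨κ, τ, _, _, s, e, coeff, y, term, ⟨hy, hgen⟩, hb⟩ := hA (ι ⊕ J) σ' b
  have ha (i) : a i = ∑ k, A.map (term k (.inl i)).op (y k) := hb (.inl i)
  have hc (j : J) : j.1.1.const j.2 = ∑ k, A.map (term k (.inr j)).op (y k) := hb (.inr j)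
  -- the equations of the cells, their constant terms written as linear terms in `y`
  let s' : κ ⊕ K → C := Sum.elim s fun k => k.1.1.sys.varSort k.2
  let e' : τ ⊕ J → C := Sum.elim e fun j => j.1.1.sys.eqSort j.2
  let coeff' (k : κ ⊕ K) (j : τ ⊕ J) : e' j ⟶ s' k := match k, j with
    | .inl k, .inl j => coeff k j
    | .inl k, .inr j => term k (.inr j)
    | .inr _, .inl _ => 0
    | .inr k, .inr j => FinSystem.blockCoeff (fun c : T => c.1.sys) k j
  let term' (k : κ ⊕ K) (i : ι) : σ i ⟶ s' k := match k with
    | .inl k => term k (.inl i)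
    | .inr k => r i k.1 k.2
  let y' (k : κ ⊕ K) : (_root_.extension D g).obj (op (s' k)) := match k with
    | .inl k => (extensionIncl D g).app _ (y k)
    | .inr k => Adjoin.gen A (fun c : Cell D g => c.sys) Cell.const k.1 k.2
  have hcoeff (N : Cᵒᵖ ⥤ AddCommGrpCat.{max u v w}) [N.Additive]
      (z : ∀ k, N.obj (op (s' k))) : (∀ j, ∑ k, N.map (coeff' k j).op (z k) = 0) ↔
      (∀ j, ∑ k, N.map (coeff k j).op (z (.inl k)) = 0) ∧
        ∀ c : T, c.1.sys.Solves N (fun j => ∑ k, N.map (term k (.inr ⟨c, j⟩)).op (z (.inl k)))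
          fun k => z (.inr ⟨c, k⟩) := by
    rw [Sum.forall]
    refine and_congr (forall_congr' fun j => ?_)
      (Sigma.forall.trans (forall_congr' fun c => forall_congr' fun j => ?_))
    · rw [Fintype.sum_sum_type]
      have h0 (k : K) : N.map (coeff' (.inr k) (.inl j)).op (z (.inr k)) = 0 :=
        map_zero_op N (z (.inr k))
      rw [Finset.sum_eq_zero fun k _ => h0 k, add_zero]
      exact Iff.rfl
    · rw [Fintype.sum_sum_type]
      have h0 : ∑ k : K, N.map (coeff' (.inr k) (.inr ⟨c, j⟩)).op (z (.inr k)) =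
          ∑ k, N.map (c.1.sys.coeff k j).op (z (.inr ⟨c, k⟩)) :=
        FinSystem.sum_map_blockCoeff (fun c : T => c.1.sys) N (fun k => z (.inr k)) ⟨c, j⟩
      rw [h0]
      exact Iff.rfl
  have hmap {N : Cᵒᵖ ⥤ AddCommGrpCat.{max u v w}} (f : A ⟶ N) (j : J) :
      f.app _ (j.1.1.const j.2) = ∑ k, N.map (term k (.inr j)).op (f.app _ (y k)) := by
    rw [hc]
    exact app_sum_map f _ y
  refine ⟨κ ⊕ K, τ ⊕ J, inferInstance, inferInstance, s', e', coeff', y', term',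
    ⟨(hcoeff _ y').2 ⟨fun j => ?_, fun c => ?_⟩, fun N hN z hz => ?_⟩, fun i => ?_⟩
  · refine (app_sum_map (extensionIncl D g) (fun k => coeff k j) y).symm.trans ?_
    rw [hy, map_zero]
  · have h := Adjoin.solves_gen A (fun c : Cell D g => c.sys) Cell.const c.1
    intro j
    refine Eq.trans ?_ (h j)
    exact congrArg₂ (· + ·) (hmap (extensionIncl D g) ⟨c, j⟩).symm rfl
  · have := hD N hN
    obtain ⟨hz₁, hz₂⟩ := (hcoeff N z).1 hz
    obtain ⟨f, hf⟩ := hgen N hN (fun k => z (.inl k)) hz₁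
    obtain ⟨f', hf', hz'⟩ := exists_extension_desc g hD hN f T
      (fun c k => z (.inr ⟨c, k⟩)) (fun c j => by
        refine Eq.trans ?_ (hz₂ c j)
        refine congrArg₂ (· + ·) ?_ rfl
        refine (hmap f ⟨c, j⟩).trans ?_
        exact Finset.sum_congr rfl fun k _ => congrArg _ (hf k))
    refine ⟨f', fun k => ?_⟩
    match k with
    | .inl k =>
      refine Eq.trans ?_ (hf k)
      rw [← hf']
      rfl
    | .inr k => exact hz' k.1 k.2
  · rw [hT i, Fintype.sum_sum_type, ha i]
    refine congrArg₂ (· + ·) ?_ ?_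
    · exact app_sum_map (extensionIncl D g) _ y
    · rw [Fintype.sum_sigma, ← Finset.sum_coe_sort]
      rfl

end Step
end

/-! ### Unions of chains -/

section

variable {C : Type u} [Category.{v} C]

section Colimit

open Limits

variable {F : ℕ ⥤ Cᵒᵖ ⥤ AddCommGrpCat.{w}}

lemma preservesColimit_forget (G : ℕ ⥤ AddCommGrpCat.{w}) :
    PreservesColimit G (forget AddCommGrpCat.{w}) := by
  have := preservesFilteredColimitsOfSize_shrink.{0, w, 0, w} (forget AddCommGrpCat.{w})
  infer_instance

lemma exists_colimit_rep {X : Cᵒᵖ} (x : (colimit F).obj X) :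
    ∃ n a, (colimit.ι F n).app X a = x := by
  have := preservesColimit_forget (F ⋙ (evaluation _ _).obj X)
  exact Concrete.isColimit_exists_rep _
    (isColimitOfPreserves ((evaluation _ _).obj X) (colimit.isColimit F)) x

lemma exists_map_eq_of_colimit_eq {X : Cᵒᵖ} {n : ℕ} {x y : (F.obj n).obj X}
    (h : (colimit.ι F n).app X x = (colimit.ι F n).app X y) :
    ∃ m, ∃ h : n ≤ m, (F.map (homOfLE h)).app X x = (F.map (homOfLE h)).app X y := by
  have := preservesColimit_forget (F ⋙ (evaluation _ _).obj X)
  obtain ⟨m, f, g, h⟩ := Concrete.isColimit_exists_of_rep_eq _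
    (isColimitOfPreserves ((evaluation _ _).obj X) (colimit.isColimit F)) x y h
  exact ⟨m, leOfHom f, h⟩

lemma colimit_ι_map_app {n m : ℕ} (h : n ⟶ m) {X : Cᵒᵖ} (x : (F.obj n).obj X) :
    (colimit.ι F m).app X ((F.map h).app X x) = (colimit.ι F n).app X x := by
  rw [← colimit.w F h]
  rfl

lemma exists_colimit_rep_family {ι : Type*} [Finite ι] {σ : ι → C}
    (x : ∀ i, (colimit F).obj (op (σ i))) :
    ∃ n, ∃ a : ∀ i, (F.obj n).obj (op (σ i)), ∀ i, (colimit.ι F n).app _ (a i) = x i := by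
  choose n a ha using fun i => exists_colimit_rep (x i)
  obtain ⟨m, hm⟩ := Finite.bddAbove_range n
  refine ⟨m, fun i => (F.map (homOfLE (hm ⟨i, rfl⟩))).app _ (a i), fun i => ?_⟩
  rw [colimit_ι_map_app, ha]

/-- Being finite, a pp formula that holds in the union of a chain holds at some stage. -/
lemma exists_mem_sol_of_colimit {n : ℕ} {σ : Fin n → C} {φ : PPFormula σ}
    {x : ∀ i, (colimit F).obj (op (σ i))} (hx : x ∈ φ.sol (colimit F)) :
    ∃ m, ∃ a ∈ φ.sol (F.obj m), ∀ i, (colimit.ι F m).app _ (a i) = x i := by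
  obtain ⟨y, hy⟩ := hx
  let z (q : Fin n ⊕ Fin φ.numBound) :
      (colimit F).obj (op (Sum.elim σ φ.boundSort q)) := match q with
    | .inl i => x i
    | .inr k => y k
  obtain ⟨m, c, hc⟩ := exists_colimit_rep_family z
  let a (i : Fin n) : (F.obj m).obj (op (σ i)) := c (.inl i)
  let b (k : Fin φ.numBound) : (F.obj m).obj (op (φ.boundSort k)) := c (.inr k)
  have ha (i) : (colimit.ι F m).app _ (a i) = x i := hc (.inl i)
  have hb (k) : (colimit.ι F m).app _ (b k) = y k := hc (.inr k)
  have h (j) : (colimit.ι F m).app _ (∑ i, (F.obj m).map (φ.freeCoeff i j).op (a i) +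
      ∑ k, (F.obj m).map (φ.boundCoeff k j).op (b k)) = (colimit.ι F m).app _ 0 := by
    rw [map_add, app_sum_map, app_sum_map, map_zero]
    simpa only [ha, hb] using hy j
  choose p hp hp' using fun j => exists_map_eq_of_colimit_eq (h j)
  obtain ⟨q, hq⟩ := Finite.bddAbove_range p
  have hmq : m ≤ max m q := le_max_left _ _
  refine ⟨max m q, fun i => (F.map (homOfLE hmq)).app _ (a i),
    ⟨fun k => (F.map (homOfLE hmq)).app _ (b k), fun j => ?_⟩, fun i => ?_⟩
  · have hpq : p j ≤ max m q := (hq ⟨j, rfl⟩).trans (le_max_right _ _)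
    have e : F.map (homOfLE hmq) = F.map (homOfLE (hp j)) ≫ F.map (homOfLE hpq) := by
      rw [← F.map_comp]; rfl
    rw [← app_sum_map, ← app_sum_map, ← map_add, e]
    have := congrArg ((F.map (homOfLE hpq)).app _) (hp' j)
    rw [map_zero, map_zero] at this
    exact this
  · rw [colimit_ι_map_app, ha]

lemma additive_colimit [Preadditive C] [∀ n, (F.obj n).Additive] : (colimit F).Additive where
  map_add {X Y r r'} := by
    ext x
    obtain ⟨n, a, rfl⟩ := exists_colimit_rep x
    simp [← NatTrans.naturality_apply, Functor.map_add]

end Colimit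

/-- If morphisms to `N` extend along each map of a sequence, then a morphism to `N` from one stage
extends to a compatible family on all stages. -/
lemma exists_compatible_family {E : Type*} [Category E] {N : E} {X : ℕ → E}
    (f : ∀ n, X n ⟶ X (n + 1)) (hf : ∀ n (h : X n ⟶ N), ∃ h', f n ≫ h' = h) (n : ℕ)
    (h : X n ⟶ N) : ∃ H : ∀ k, X k ⟶ N, (∀ k, f k ≫ H (k + 1) = H k) ∧ H n = h := by
  induction n generalizing X with
  | zero =>
    choose g hg using hf
    exact ⟨fun k => Nat.rec h g k, fun k => hg _ _, rfl⟩
  | succ n ih =>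
    obtain ⟨H, hH, rfl⟩ := ih (X := fun k => X (k + 1)) (fun k => f (k + 1))
      (fun k => hf (k + 1)) h
    refine ⟨fun k => match k with
      | 0 => f 0 ≫ H 0
      | k + 1 => H k, fun k => ?_, rfl⟩
    match k with
    | 0 => rfl
    | k + 1 => exact hH k

section Tower

variable [Preadditive C] (D : ObjectProperty (Cᵒᵖ ⥤ AddCommGrpCat.{max u v w}))
  (M : Cᵒᵖ ⥤ AddCommGrpCat.{max u v w})

/-- A locally generic module with a morphism to `M`. -/
structure LocallyGenericOver where
  obj : Cᵒᵖ ⥤ AddCommGrpCat.{max u v w}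
  additive : obj.Additive
  hom : obj ⟶ M
  isLocallyGeneric : IsLocallyGeneric D obj

attribute [instance] LocallyGenericOver.additive

/-- The zero module over `M`. -/
def LocallyGenericOver.zero [M.Additive] : LocallyGenericOver.{u, v, w} D M where
  obj := (Functor.const _).obj (AddCommGrpCat.of PUnit)
  additive := ⟨rfl⟩
  hom := { app := fun _ => 0 }
  isLocallyGeneric := fun ι _ σ a =>
    ⟨PEmpty, PEmpty, inferInstance, inferInstance, PEmpty.elim, PEmpty.elim,
      fun k => k.elim, fun k => k.elim, fun k => k.elim,
      ⟨fun j => j.elim, fun N _ _ _ => ⟨{ app := fun _ => 0 }, fun k => k.elim⟩⟩,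
      fun _ => rfl⟩

variable {D M}

/-- The extension of a locally generic module over `M` by all its cells. -/
noncomputable def LocallyGenericOver.next [M.Additive] (hD : ∀ N, D N → N.Additive)
    (A : LocallyGenericOver.{u, v, w} D M) : LocallyGenericOver.{u, v, w} D M where
  obj := extension D A.hom
  additive := inferInstance
  hom := extensionDesc A.hom
  isLocallyGeneric := A.isLocallyGeneric.extension A.hom hD

/-- The sequence of modules over `M` that starts with zero and adjoins all cells at each step. -/
noncomputable def tower [M.Additive] (hD : ∀ N, D N → N.Additive) :
    ℕ → LocallyGenericOver.{u, v, w} D M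
  | 0 => .zero D M
  | n + 1 => (tower hD n).next hD

/-- The transition maps of the tower. -/
noncomputable abbrev towerIncl [M.Additive] (hD : ∀ N, D N → N.Additive) (n : ℕ) :
    (tower (M := M) hD n).obj ⟶ (tower (M := M) hD (n + 1)).obj :=
  extensionIncl D (tower hD n).hom

end Tower
end

/-! ### The generic cover -/

section

variable {C : Type u} [Category.{v} C]

section Cover

open Limits

variable [Preadditive C] {D : ObjectProperty (Cᵒᵖ ⥤ AddCommGrpCat.{max u v w})}
  {M : Cᵒᵖ ⥤ AddCommGrpCat.{max u v w}} [M.Additive] (hD : ∀ N, D N → N.Additive)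

/-- The tower as a functor. -/
noncomputable abbrev towerFunctor (M : Cᵒᵖ ⥤ AddCommGrpCat.{max u v w}) [M.Additive]
    (hD : ∀ N, D N → N.Additive) : ℕ ⥤ Cᵒᵖ ⥤ AddCommGrpCat.{max u v w} :=
  Functor.ofSequence (towerIncl (M := M) hD)

/-- The union of the tower: a locally generic pure cover of `M`, in `D` if `M` is. -/
noncomputable abbrev genericCover (M : Cᵒᵖ ⥤ AddCommGrpCat.{max u v w}) [M.Additive]
    (hD : ∀ N, D N → N.Additive) : Cᵒᵖ ⥤ AddCommGrpCat.{max u v w} :=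
  colimit (towerFunctor M hD)

lemma exists_genericCover_desc {N : Cᵒᵖ ⥤ AddCommGrpCat.{max u v w}}
    (H : ∀ n, (tower (M := M) hD n).obj ⟶ N) (hH : ∀ n, towerIncl hD n ≫ H (n + 1) = H n) :
    ∃ f : genericCover M hD ⟶ N, ∀ n, colimit.ι (towerFunctor M hD) n ≫ f = H n :=
  ⟨colimit.desc (towerFunctor M hD) ⟨N, NatTrans.ofSequence H fun n => by
    rw [Functor.ofSequence_map_homOfLE_succ]
    exact (hH n).trans (Category.comp_id _).symm⟩, fun n => colimit.ι_desc _ _⟩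

lemma exists_extend_to_genericCover {N : Cᵒᵖ ⥤ AddCommGrpCat.{max u v w}} (hN : D N) (n : ℕ)
    (h : (tower (M := M) hD n).obj ⟶ N) :
    ∃ f : genericCover M hD ⟶ N, colimit.ι (towerFunctor M hD) n ≫ f = h := by
  obtain ⟨H, hH, rfl⟩ := exists_compatible_family (towerIncl (M := M) hD)
    (fun n h => exists_extension_comp_eq _ hD hN h) n h
  obtain ⟨f, hf⟩ := exists_genericCover_desc hD H hH
  exact ⟨f, hf n⟩

lemma isLocallyGeneric_genericCover : IsLocallyGeneric D (genericCover M hD) := by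
  intro ι _ σ x
  obtain ⟨n, a, ha⟩ := exists_colimit_rep_family x
  obtain ⟨κ, τ, _, _, s, e, coeff, y, term, ⟨hy, hgen⟩, hterm⟩ :=
    (tower (M := M) hD n).isLocallyGeneric ι σ a
  refine ⟨κ, τ, inferInstance, inferInstance, s, e, coeff,
    fun k => (colimit.ι (towerFunctor M hD) n).app _ (y k), term,
    ⟨fun j => ?_, fun N hN z hz => ?_⟩, fun i => ?_⟩
  · refine (app_sum_map (colimit.ι (towerFunctor M hD) n) (fun k => coeff k j) y).symm.trans ?_
    exact (congrArg _ (hy j)).trans (map_zero _)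
  · obtain ⟨f, hf⟩ := hgen N hN z hz
    obtain ⟨f', rfl⟩ := exists_extend_to_genericCover hD hN n f
    exact ⟨f', hf⟩
  · rw [← ha i]
    refine (congrArg _ (hterm i)).trans ?_
    exact app_sum_map (colimit.ι (towerFunctor M hD) n) (fun k => term k i) y

/-- If `φ ≤_D ψ` and `a ∈ φ` holds at a stage, then the system of `ψ(a)` is a cell there, so the
next stage contains a witness. -/
lemma sol_genericCover_subset (hM : D M) {n : ℕ} {σ : Fin n → C} {φ ψ : PPFormula σ}
    (h : φ.LeOn D ψ) : φ.sol (genericCover M hD) ⊆ ψ.sol (genericCover M hD) := by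
  intro x hx
  obtain ⟨m, a, ha, hax⟩ := exists_mem_sol_of_colimit hx
  have hsolv (N) (hN : D N) (f : (tower (M := M) hD m).obj ⟶ N) :
      ∃ y, ψ.boundSystem.Solves N (fun j => f.app _ (ψ.freePart _ a j)) y := by
    obtain ⟨y, hy⟩ := (ψ.mem_sol_iff N _).1 (h N hN (PPFormula.map_mem_sol f ha))
    exact ⟨y, fun j => (congrArg₂ (· + ·) (ψ.freePart_map f a j) rfl).trans (hy j)⟩
  obtain ⟨b, hb⟩ := hsolv M hM (tower hD m).hom
  obtain ⟨y, hy, -⟩ := exists_solves_extension (D := D) (tower hD m).hom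
    ⟨ψ.boundSystem, ψ.freePart _ a, hsolv, b, hb⟩
  have hy' := hy.map (colimit.ι (towerFunctor M hD) (m + 1))
  refine (ψ.mem_sol_iff _ x).2 ⟨_, fun j => (congrArg₂ (· + ·) ?_ rfl).trans (hy' j)⟩
  rw [← funext hax, ← PPFormula.freePart_map,
    ← colimit.w (towerFunctor M hD) (homOfLE (m.le_add_right 1)),
    Functor.ofSequence_map_homOfLE_succ]
  rfl

lemma IsDefinable.mem_of_leOn (hdef : IsDefinable D) (P : Cᵒᵖ ⥤ AddCommGrpCat.{max u v w})
    [P.Additive] (hP : ∀ (n : ℕ) (σ : Fin n → C) (φ ψ : PPFormula σ), φ.LeOn D ψ →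
      φ.sol P ⊆ ψ.sol P) : D P := by
  obtain ⟨Φ, hΦ⟩ := hdef
  refine (hΦ P).2 ⟨inferInstance, fun p hp => Set.Subset.antisymm (hP _ _ _ _ fun N hN => ?_)
    (hP _ _ _ _ fun N hN => ?_)⟩
  · exact (((hΦ N).1 hN).2 p hp).subset
  · exact (((hΦ N).1 hN).2 p hp).superset

lemma IsDefinable.genericCover_mem (hdef : IsDefinable D) (hM : D M) : D (genericCover M hD) := by
  have (n : ℕ) : ((towerFunctor M hD).obj n).Additive := (tower hD n).additive
  have := additive_colimit (F := towerFunctor M hD)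
  exact hdef.mem_of_leOn _ fun n σ φ ψ => sol_genericCover_subset hD hM

/-- A homogeneous system is solvable in every module by zero, so each of its solutions in `M` gives
a cell over the bottom stage and is thereby lifted. -/
lemma exists_isPureEpi_genericCover : ∃ π : genericCover M hD ⟶ M, IsPureEpi π := by
  obtain ⟨π, hπ⟩ := exists_genericCover_desc hD (fun n => (tower.{u, v, w} (M := M) hD n).hom)
    (fun n => extensionIncl_desc _)
  refine ⟨π, .of_lift π fun S y hy => ?_⟩
  obtain ⟨x, hx, hxy⟩ := exists_solves_extension (D := D) (tower.{u, v, w} (M := M) hD 0).hom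
    { sys := S
      const := fun _ => 0
      solvable := fun N _ h => ⟨fun _ => 0, fun j => by simp⟩
      sol := y
      solves_sol := by simpa only [map_zero] using hy }
  refine ⟨fun k => (colimit.ι (towerFunctor M hD) 1).app _ (x k), ?_, fun k => ?_⟩
  · intro j
    refine (congrArg₂ (· + ·) ?_ rfl).trans (hx.map (colimit.ι (towerFunctor M hD) 1) j)
    exact ((congrArg _ (map_zero _)).trans (map_zero _)).symm
  · refine Eq.trans ?_ (hxy k)
    exact congrArg (fun f => f.app _ (x k)) (hπ 1)

end Cover

/-! ### Strict atomicity and reduced powers -/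

section StrictlyAtomic

/-- In a locally generic module of `D`, the pp-type of a tuple is generated by a formula whose
solutions in `D` are all images of the tuple. -/
lemma IsLocallyGeneric.exists_formula [Preadditive C] {D : ObjectProperty (Cᵒᵖ ⥤ AddCommGrpCat.{w})}
    (hD : ∀ N, D N → N.Additive) {P : Cᵒᵖ ⥤ AddCommGrpCat.{w}} (hP : IsLocallyGeneric D P)
    (hDP : D P) {n : ℕ} {σ : Fin n → C} (d : ∀ i, P.obj (op (σ i))) :
    ∃ φ : PPFormula σ, ppType P d = φ.generatedType D ∧
      ∀ N, D N → ∀ b ∈ φ.sol N, ∃ f : P ⟶ N, ∀ i, f.app _ (d i) = b i := by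
  obtain ⟨κ, τ, _, _, s, e, coeff, y, term, ⟨hy, hgen⟩, hterm⟩ :=
    hP (ULift (Fin n)) (fun i => σ i.down) (fun i => d i.down)
  let φ : PPFormula σ := .image s e coeff fun k i => term k ⟨i⟩
  have hφ : ∀ N, D N → ∀ b ∈ φ.sol N, ∃ f : P ⟶ N, ∀ i, f.app _ (d i) = b i := by
    intro N hN b hb
    have := hD N hN
    obtain ⟨z, hz, hbz⟩ := (PPFormula.mem_sol_image _ _ _ _ _ _).1 hb
    obtain ⟨f, hf⟩ := hgen N hN z hz
    refine ⟨f, fun i => ?_⟩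
    have hi : d i = ∑ k, P.map (term k ⟨i⟩).op (y k) := hterm ⟨i⟩
    rw [hi, hbz i, app_sum_map f (fun k => term k ⟨i⟩)]
    simp only [hf]
  refine ⟨φ, Set.Subset.antisymm (fun ψ hψ N hN b hb => ?_) fun ψ hψ => hψ P hDP ?_, hφ⟩
  · obtain ⟨f, hf⟩ := hφ N hN b hb
    rw [← funext hf]
    exact PPFormula.map_mem_sol f hψ
  · have := hD P hDP
    exact (PPFormula.mem_sol_image _ _ _ _ _ _).2 ⟨y, hy, fun i => hterm ⟨i⟩⟩

lemma ppType_eq_of_section {M P : Cᵒᵖ ⥤ AddCommGrpCat.{w}} (f : M ⟶ P) (π : P ⟶ M) {n : ℕ}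
    {σ : Fin n → C} {a : ∀ i, M.obj (op (σ i))}
    (h : ∀ i, π.app _ (f.app _ (a i)) = a i) :
    ppType M a = ppType P fun i => f.app _ (a i) := by
  refine Set.Subset.antisymm (fun ψ hψ => PPFormula.map_mem_sol f hψ) fun ψ hψ => ?_
  have := PPFormula.map_mem_sol π hψ
  rwa [funext h] at this

/-- Strict atomicity passes from `P` to `M` if the identity of `M` factors through `P` on each
finite tuple. -/
lemma IsLocallyGeneric.isStrictlyAtomicIn_of_locally_split [Preadditive C]
    {D : ObjectProperty (Cᵒᵖ ⥤ AddCommGrpCat.{w})}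
    (hD : ∀ N, D N → N.Additive) {M P : Cᵒᵖ ⥤ AddCommGrpCat.{w}} (hP : IsLocallyGeneric D P)
    (hDP : D P) (π : P ⟶ M)
    (h : ∀ (n : ℕ) (σ : Fin n → C) (a : ∀ i, M.obj (op (σ i))),
      ∃ f : M ⟶ P, ∀ i, π.app _ (f.app _ (a i)) = a i) : IsStrictlyAtomicIn D M := by
  constructor
  · intro n σ a
    obtain ⟨f, hf⟩ := h n σ a
    obtain ⟨φ, hφ, -⟩ := hP.exists_formula hD hDP fun i => f.app _ (a i)
    exact ⟨φ, (ppType_eq_of_section f π hf).trans hφ⟩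
  · intro n σ a ψ hψ N hN b hb
    obtain ⟨f, hf⟩ := h n σ a
    obtain ⟨φ, hφ, hreal⟩ := hP.exists_formula hD hDP fun i => f.app _ (a i)
    have hle : φ ∈ ψ.generatedType D := by
      rw [← hψ, ppType_eq_of_section f π hf, hφ]
      exact fun _ _ => subset_rfl
    obtain ⟨g, hg⟩ := hreal N hN b (hle N hN hb)
    exact ⟨f ≫ g, hg⟩

end StrictlyAtomic

section ReducedPower

variable {Λ : Type w} {F : Filter Λ} {M P : Cᵒᵖ ⥤ AddCommGrpCat.{w}}

/-- The equation in the reduced power says that `π ∘ fₗ` fixes each single element for `F`-many `l`.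
-/
lemma diagonal_comp_eq_iff (f : Λ → (M ⟶ P)) (π : P ⟶ M) :
    diagonal F M ≫ reducedProductMap F f ≫ reducedProductMap F (fun _ => π) = diagonal F M ↔
      ∀ (X : C) (c : M.obj (op X)), ∀ᶠ l in F, π.app _ ((f l).app _ c) = c := by
  constructor
  · intro h X c
    have := congrArg (fun g => g.app (op X) c) h
    exact Filter.Germ.coe_eq.1 this
  · intro h
    ext X c
    exact Filter.Germ.coe_eq.2 (h X.unop c)

end ReducedPower

/-- A pure epimorphism in `D` onto a strictly atomic module splits on each finite tuple: lift the
tuple to a solution of the formula that generates its pp-type. -/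
lemma IsStrictlyAtomicIn.exists_section_on_tuple [Preadditive C]
    {D : ObjectProperty (Cᵒᵖ ⥤ AddCommGrpCat.{w})} {M P : Cᵒᵖ ⥤ AddCommGrpCat.{w}} [P.Additive]
    (hM : IsStrictlyAtomicIn D M) (hDP : D P) {π : P ⟶ M} (hπ : IsPureEpi π) {n : ℕ}
    {σ : Fin n → C} (a : ∀ i, M.obj (op (σ i))) :
    ∃ f : M ⟶ P, ∀ i, π.app _ (f.app _ (a i)) = a i := by
  obtain ⟨φ, hφ⟩ := hM.1 n σ a
  have ha : φ ∈ ppType M a := hφ ▸ fun _ _ => subset_rfl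
  obtain ⟨b, hb, hba⟩ := hπ.exists_lift ha
  obtain ⟨f, hf⟩ := hM.2 n σ a φ hφ P hDP b hb
  exact ⟨f, fun i => by rw [hf, hba]⟩

end

theorem theorem4p5 {C : Type u} [Category.{v} C] [Preadditive C]
    (D : ObjectProperty (Cᵒᵖ ⥤ AddCommGrpCat.{max u v w})) (hD : IsDefinable D)
    (M : Cᵒᵖ ⥤ AddCommGrpCat.{max u v w}) (hM : D M) :
    IsStrictlyAtomicIn D M ↔
      ∃ (Λ : Type (max u v w)) (F : Filter Λ), F.NeBot ∧
        ∀ (P : Cᵒᵖ ⥤ AddCommGrpCat.{max u v w}) (π : P ⟶ M), D P → IsPureEpi π →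
          ∃ f : Λ → (M ⟶ P),
            diagonal F M ≫ reducedProductMap F f ≫ reducedProductMap F (fun _ => π) =
              diagonal F M := by
  have hadd : ∀ N, D N → N.Additive := fun N hN => by
    obtain ⟨Φ, hΦ⟩ := hD
    exact ((hΦ N).1 hN).1
  have := hadd M hM
  constructor
  · intro h
    classical
    refine ⟨Finset (Σ X : C, M.obj (op X)), Filter.atTop, inferInstance, fun P π hP hπ => ?_⟩
    have := hadd P hP
    have hf (l : Finset (Σ X : C, M.obj (op X))) :
        ∃ f : M ⟶ P, ∀ p ∈ l, π.app _ (f.app _ p.2) = p.2 := by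
      obtain ⟨f, hf⟩ := h.exists_section_on_tuple hP hπ
        (fun i => (l.equivFin.symm i).1.2)
      refine ⟨f, fun p hp => ?_⟩
      have := hf (l.equivFin ⟨p, hp⟩)
      rwa [Equiv.symm_apply_apply] at this
    choose f hf using hf
    refine ⟨f, (diagonal_comp_eq_iff f π).2 fun X c => ?_⟩
    filter_upwards [Filter.eventually_ge_atTop {⟨X, c⟩}] with l hl
    exact hf l ⟨X, c⟩ (hl (Finset.mem_singleton_self _))
  · rintro ⟨Λ, F, hF, h⟩
    obtain ⟨π, hπ⟩ := exists_isPureEpi_genericCover (D := D) (M := M) hadd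
    have hP := hD.genericCover_mem (M := M) hadd hM
    obtain ⟨f, hf⟩ := h _ π hP hπ
    rw [diagonal_comp_eq_iff] at hf
    refine (isLocallyGeneric_genericCover hadd).isStrictlyAtomicIn_of_locally_split hadd hP π
      fun n σ a => ?_
    obtain ⟨l, hl⟩ := (Filter.eventually_all.2 fun i => hf _ (a i)).exists
    exact ⟨f l, hl⟩
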